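/- Let $\mathscr H$ be a complex Hilbert space of arbitrary dimension, let $A,B$ be positive (that is, positive semidefinite) bounded operators on $\mathscr H$, let $t\le 2$ be real and let $r\in[\frac12,\frac32]$. Let $|||\cdot|||$ be a unitarily invariant norm with norm ideal $\mathfrak J$, i.e. $\mathfrak J$ is a two-sided ideal of $\mathbb B(\mathscr H)$ and $|||\cdot|||$ is a norm on $\mathfrak J$ such that $|||UXV|||=|||X|||$ for all $X\in\mathfrak J$ and all unitaries $U,V$. Let $X\in\mathfrak J$. For $p,q>0$ put $$h(p,q)=|||A^{p}XB^{q}+A^{q}XB^{p}|||,\qquad c=(4-2t)\,|||AXB||| .$$ Then $\nu\mapsto h(\nu+\frac12,\frac32-\nu)$ is integrable on $[0,1]$, and the following hold. (1) If $r\in[\frac12,1]$, then $$\begin{aligned} 2\,|||A^2X+XB^2+tAXB|||&\ge 2\,|||A^2X+XB^2+2AXB|||-c\\ &\ge 4h(\tfrac32,\tfrac12)-c\\ &\ge 2h(\tfrac32,\tfrac12)+2h(r,2-r)-c\\ &\ge \frac{4}{r-\frac12}\int_0^{r-\frac12}h(\nu+\tfrac12,\tfrac32-\nu)\,d\nu-c\\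 &\ge 4h\big(\tfrac{2r+1}{4},\tfrac{7-2r}{4}\big)-c\\ &\ge 4h(r,2-r)-c\\ &\ge (t+2)\,h(r,2-r). \end{aligned}$$ (2) If $r\in[1,\frac32]$, then $$\begin{aligned} 2\,|||A^2X+XB^2+tAXB|||&\ge 2\,|||A^2X+XB^2+2AXB|||-c\\ &\ge 4h(\tfrac32,\tfrac12)-c\\ &\ge 2h(\tfrac32,\tfrac12)+2h(r,2-r)-c\\ &\ge \frac{4}{\frac32-r}\int_{r-\frac12}^{1}h(\nu+\tfrac12,\tfrac32-\nu)\,d\nu-c\\ &\ge 4h\big(\tfrac{2r+3}{4},\tfrac{5-2r}{4}\big)-c\\ &\ge 4h(r,2-r)-c\\ &\ge (t+2)\,h(r,2-r). \end{aligned}$$ Here, for $r=\frac12$ in (1) and for $r=\frac32$ in (2), the integral mean $\frac{1}{r-1/2}\int_0^{r-1/2}$, respectively $\frac{1}{3/2-r}\int_{r-1/2}^{1}$, is understood as its limit as $r\downarrow\frac12$, respectively $r\uparrow\frac32$; these limits exist and are equal to $h(\frac12,\frac32)$ and $h(\frac32,\frac12)$ respectively. -/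

import Mathlib

open Set Filter Topology MeasureTheory

/-- A unitarily invariant norm on the bounded operators of a complex Hilbert space `H`, together with
the two-sided ideal of `B(H)` (its norm ideal) on which it is defined. The values of `norm` outside
`ideal` carry no information. Neither completeness of the ideal nor a normalization on operators
of rank one is required. -/
structure UnitarilyInvariantNorm (H : Type*) [NormedAddCommGroup H] [InnerProductSpace ℂ H]
    [CompleteSpace H] where
  ideal : TwoSidedIdeal (H →L[ℂ] H)
  norm : (H →L[ℂ] H) → ℝ
  eq_zero_of_norm_eq_zero : ∀ X ∈ ideal, norm X = 0 → X = 0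
  norm_add_le : ∀ X ∈ ideal, ∀ Y ∈ ideal, norm (X + Y) ≤ norm X + norm Y
  norm_smul : ∀ (c : ℂ), ∀ X ∈ ideal, norm (c • X) = ‖c‖ * norm X
  norm_unitary_mul_mul_unitary :
    ∀ U ∈ unitary (H →L[ℂ] H), ∀ V ∈ unitary (H →L[ℂ] H), ∀ X ∈ ideal, norm (U * X * V) = norm X

/-- The operator `A^p X B^q + A^q X B^p`. The real powers of positive operators are those of the
continuous functional calculus. -/
noncomputable def heinzSum {H : Type*} [NormedAddCommGroup H] [InnerProductSpace ℂ H]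
    [CompleteSpace H] (A B X : H →L[ℂ] H) (p q : ℝ) : H →L[ℂ] H :=
  A ^ p * X * B ^ q + A ^ q * X * B ^ p

/-- The integral mean `(1 / (b - a)) ∫_a^b f` of a function over an interval; on the degenerate
interval `a = b` it is the value `f a`, the limit of the means of a continuous `f` over intervals
shrinking to `a`. -/
noncomputable def intervalMean (f : ℝ → ℝ) (a b : ℝ) : ℝ :=
  if a = b then f a else 1 / (b - a) * ∫ ν in a..b, f ν

/-! The theorem follows from one inequality, `UnitarilyInvariantNorm.two_mul_norm_mul_mul_le`: for
positive `C`, `D` and `Y` in the ideal, `2 |||C Y D||| ≤ |||C ^ 2 Y + Y D ^ 2|||`.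

Let `F ν = |||A ^ (ν + 1/2) X B ^ (3/2 - ν) + A ^ (3/2 - ν) X B ^ (ν + 1/2)|||`. Choosing `C`, `D`
to be powers `A ^ δ`, `B ^ δ` in that inequality gives the midpoint convexity of `F`
(`two_mul_norm_heinzSum_le`). Since `F` is continuous, it is convex on `[0, 1]`; it is symmetric
about `1/2`, so it decreases on `[0, 1/2]`. The inequalities between values of `F` and its
integral means are then monotonicity and the Hermite-Hadamard inequality, and the last one is
`F (1/2) ≤ F ν`, where `F (1/2) = 2 |||A X B|||`. Choosing `C = A ^ (1/2)`, `D = B ^ (1/2)` and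
`Y = A X + X B` gives the comparison of `|||A ^ 2 X + X B ^ 2 + 2 A X B|||` with `F 1`. The first
inequality is the triangle inequality.

The norm is neither assumed complete nor lower semicontinuous, and `H` may be
infinite-dimensional, so neither majorization nor weak integrals of unitary conjugates are
available. Instead, after adding `ε` to `C` and `D`, write `C = exp S` and `D = exp K`. The
operators `Φ z : Z ↦ exp (z S) Z exp (-z K)` on the ideal form a group that is isometric on the
imaginary axis, with generator `T Z = S Z - Z K`, and the claim is that
`cosh T = (Φ 1 + Φ (-1)) / 2` does not decrease norms. Isometry makes `i T` dissipative, hence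
`1 + i s T` does not decrease norms for any real `s` (`norm_le_norm_add_smul_generator`). For odd
`n` the polynomial `(1 + T / n) ^ n + (1 - T / n) ^ n` has only imaginary zeros and is therefore a
product of multiples of such factors; it tends to `2 cosh T` as `n → ∞`
(`two_mul_norm_le_norm_add_neg`). -/

/-! ### One-parameter groups on normed spaces -/

section OneParameterGroup

variable {V : Type*} [NormedAddCommGroup V] [NormedSpace ℂ V]

/-- The Cayley transform maps the unit circle, without `-1`, into the imaginary axis. -/
theorem exists_ofReal_mul_I_eq_of_norm_eq_one {ζ : ℂ} (hζ : ‖ζ‖ = 1) (h : 1 + ζ ≠ 0) :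
    ∃ s : ℝ, 1 - ζ = (1 + ζ) * (s * Complex.I) := by
  refine ⟨((1 - ζ) / (1 + ζ)).im, ?_⟩
  have hζ0 : ζ ≠ 0 := by rintro rfl; simp at hζ
  have hc : (starRingEnd ℂ) ζ = ζ⁻¹ := by
    rw [Complex.inv_def, Complex.normSq_eq_norm_sq, hζ]; simp
  have hw : (starRingEnd ℂ) ((1 - ζ) / (1 + ζ)) = -((1 - ζ) / (1 + ζ)) := by
    have h' : 1 + ζ⁻¹ ≠ 0 := by
      intro h0
      apply h
      have : (1 + ζ⁻¹) * ζ = 0 := by rw [h0, zero_mul]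
      rwa [add_mul, inv_mul_cancel₀ hζ0, one_mul, add_comm] at this
    simp only [map_div₀, map_sub, map_add, map_one, hc]
    rw [← neg_div, div_eq_div_iff h' h]
    field_simp
    ring
  have hre : ((1 - ζ) / (1 + ζ)).re = 0 := by
    have := congrArg Complex.re hw
    simp only [Complex.conj_re, Complex.neg_re] at this
    linarith
  have key : (1 - ζ) / (1 + ζ) = (((1 - ζ) / (1 + ζ)).im : ℂ) * Complex.I := by
    apply Complex.ext <;> simp [hre]
  rw [← key]
  field_simp

theorem norm_le_norm_factor {T : V →L[ℂ] V}
    (hT : ∀ (s : ℝ) (Z : V), ‖Z‖ ≤ ‖Z + (s * Complex.I) • T Z‖) {ζ : ℂ} (hζ : ‖ζ‖ = 1) (Z : V) :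
    ‖1 + ζ‖ * ‖Z‖ ≤ ‖(1 + ζ) • Z + (1 - ζ) • T Z‖ := by
  by_cases h : 1 + ζ = 0
  · simp [h]
  obtain ⟨s, hs⟩ := exists_ofReal_mul_I_eq_of_norm_eq_one hζ h
  rw [hs, mul_smul, ← smul_add, norm_smul]
  gcongr
  exact hT s Z

open Polynomial in
/-- The polynomial `(1 + T) ^ n + (1 - T) ^ n` is a product of the factors `(1 + ζ) + (1 - ζ) T`
over the `n`-th roots of unity `ζ`. All its zeros are imaginary, so every factor is bounded below,
and at `T = 0` the product equals `2`. -/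
theorem two_mul_norm_le_norm_pow_add_pow {T : V →L[ℂ] V}
    (hT : ∀ (s : ℝ) (Z : V), ‖Z‖ ≤ ‖Z + (s * Complex.I) • T Z‖) {n : ℕ} (hn : Odd n) (Z : V) :
    2 * ‖Z‖ ≤ ‖((1 + T) ^ n) Z + ((1 - T) ^ n) Z‖ := by
  have hn0 : n ≠ 0 := hn.pos.ne'
  have hprim := Complex.isPrimitiveRoot_exp n hn0
  -- the factors are evaluated one after the other
  have key : ∀ S : Finset ℂ, (∀ ζ ∈ S, ‖ζ‖ = 1) →
      (∏ ζ ∈ S, ‖1 + ζ‖) * ‖Z‖ ≤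
        ‖(aeval T (∏ ζ ∈ S, ((1 + X : ℂ[X]) + C ζ * (1 - X)))) Z‖ := by
    intro S
    induction S using Finset.induction_on with
    | empty => intro _; simp
    | insert ζ S hζS ih =>
      intro h
      rw [Finset.prod_insert hζS, Finset.prod_insert hζS, map_mul, mul_assoc]
      refine (mul_le_mul_of_nonneg_left
        (ih fun w hw => h w (Finset.mem_insert_of_mem hw)) (norm_nonneg _)).trans ?_
      refine (norm_le_norm_factor hT (h ζ (Finset.mem_insert_self _ _)) _).trans_eq ?_
      have hfac : aeval T ((1 + X : ℂ[X]) + C ζ * (1 - X)) = (1 + ζ) • 1 + (1 - ζ) • T := by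
        simp only [map_add, map_mul, map_sub, map_one, aeval_X, aeval_C,
          Algebra.algebraMap_eq_smul_one, smul_mul_assoc, one_mul]
        module
      rw [hfac]
      rfl
  have h1 : ∀ ζ ∈ nthRootsFinset n (1 : ℂ), ‖ζ‖ = 1 := by
    intro ζ hζ
    rw [mem_nthRootsFinset hn.pos] at hζ
    exact Complex.norm_eq_one_of_pow_eq_one hζ hn0
  have h2 : ∏ ζ ∈ nthRootsFinset n (1 : ℂ), ‖1 + ζ‖ = 2 := by
    have := hprim.pow_add_pow_eq_prod_add_mul (x := 1) (y := 1) hn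
    simp only [one_pow, mul_one] at this
    rw [← norm_prod, ← this]
    norm_num
  have h3 : ∏ ζ ∈ nthRootsFinset n (1 : ℂ), ((1 + X : ℂ[X]) + C ζ * (1 - X))
      = (1 + X) ^ n + (1 - X) ^ n := by
    refine funext fun x => ?_
    rw [eval_prod]
    simp only [eval_add, eval_mul, eval_C, eval_sub, eval_one, eval_X, eval_pow]
    exact (hprim.pow_add_pow_eq_prod_add_mul (1 + x) (1 - x) hn).symm
  have := key _ h1
  rw [h2, h3] at this
  simpa using this

theorem norm_pow_le_pow_of_norm_le {a : V →L[ℂ] V} {m : ℝ} (ha : ‖a‖ ≤ m) (k : ℕ) :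
    ‖a ^ k‖ ≤ m ^ k := by
  induction k with
  | zero => simpa using! ContinuousLinearMap.norm_id_le
  | succ k ih =>
    rw [pow_succ, pow_succ]
    exact (norm_mul_le _ _).trans
      (mul_le_mul ih ha (norm_nonneg _) ((norm_nonneg _).trans ih))

theorem norm_pow_sub_pow_le {a b : V →L[ℂ] V} {m : ℝ} (hm : 1 ≤ m) (ha : ‖a‖ ≤ m)
    (hb : ‖b‖ ≤ m) (k : ℕ) : ‖a ^ k - b ^ k‖ ≤ k * m ^ k * ‖a - b‖ := by
  induction k with
  | zero => simp
  | succ k ih =>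
    have h : a ^ (k + 1) - b ^ (k + 1) = a ^ k * (a - b) + (a ^ k - b ^ k) * b := by
      rw [pow_succ, pow_succ]; noncomm_ring
    have hmk : m ^ k ≤ m ^ (k + 1) := pow_le_pow_right₀ hm (Nat.le_succ k)
    calc ‖a ^ (k + 1) - b ^ (k + 1)‖ ≤ ‖a ^ k‖ * ‖a - b‖ + ‖a ^ k - b ^ k‖ * ‖b‖ := by
          rw [h]
          exact (norm_add_le _ _).trans (add_le_add (norm_mul_le _ _) (norm_mul_le _ _))
      _ ≤ m ^ (k + 1) * ‖a - b‖ + (k * m ^ k * ‖a - b‖) * m := by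
          gcongr
          exact (norm_pow_le_pow_of_norm_le ha k).trans hmk
      _ = ((k + 1 : ℕ) : ℝ) * m ^ (k + 1) * ‖a - b‖ := by push_cast; ring

/-- The exponential formula `Φ 1 = lim (1 + T / n) ^ n`, in a form that needs no completeness of
`V`. -/
theorem tendsto_pow_sub_one_add_pow {Φ : ℂ → V →L[ℂ] V} {T : V →L[ℂ] V} (h0 : Φ 0 = 1)
    (hΦ : HasDerivAt Φ T 0) :
    Tendsto (fun n : ℕ => Φ (n : ℂ)⁻¹ ^ n - (1 + (n : ℂ)⁻¹ • T) ^ n) atTop (𝓝 0) := by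
  have hinv : Tendsto (fun n : ℕ => ((n : ℂ))⁻¹) atTop (𝓝[≠] 0) := by
    refine tendsto_nhdsWithin_iff.2 ⟨tendsto_inv_atTop_nhds_zero_nat, ?_⟩
    filter_upwards [eventually_gt_atTop 0] with n hn
    simp [hn.ne']
  have hs : Tendsto (fun n : ℕ => (n : ℂ) • (Φ (n : ℂ)⁻¹ - 1)) atTop (𝓝 T) := by
    simpa [h0, Function.comp_def] using (hasDerivAt_iff_tendsto_slope_zero.1 hΦ).comp hinv
  have hd : Tendsto (fun n : ℕ => ‖(n : ℂ) • (Φ (n : ℂ)⁻¹ - 1) - T‖) atTop (𝓝 0) := by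
    simpa using (hs.sub_const T).norm
  rw [tendsto_zero_iff_norm_tendsto_zero]
  have hlim : Tendsto (fun n : ℕ => Real.exp (‖T‖ + 1) * ‖(n : ℂ) • (Φ (n : ℂ)⁻¹ - 1) - T‖)
      atTop (𝓝 0) := by simpa using hd.const_mul (Real.exp (‖T‖ + 1))
  refine squeeze_zero' (Eventually.of_forall fun _ => norm_nonneg _) ?_ hlim
  filter_upwards [eventually_gt_atTop 0, hs.norm.eventually_le_const (lt_add_one ‖T‖)] with n hn hb
  have hn0 : (n : ℂ) ≠ 0 := by exact_mod_cast hn.ne'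
  have hnR : (0 : ℝ) < n := by exact_mod_cast hn
  have hone : ‖(1 : V →L[ℂ] V)‖ ≤ 1 := ContinuousLinearMap.norm_id_le
  have hbound : ∀ S : V →L[ℂ] V, ‖S‖ ≤ ‖T‖ + 1 →
      ‖1 + (n : ℂ)⁻¹ • S‖ ≤ 1 + (‖T‖ + 1) / n := by
    intro S hS
    refine (norm_add_le _ _).trans (add_le_add hone ?_)
    rw [norm_smul, norm_inv, Complex.norm_natCast, div_eq_inv_mul]
    gcongr
  have ha : ‖Φ (n : ℂ)⁻¹‖ ≤ 1 + (‖T‖ + 1) / n := by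
    have := hbound _ hb
    rwa [smul_smul, inv_mul_cancel₀ hn0, one_smul, add_sub_cancel] at this
  have hb' := hbound T (by linarith)
  have hm : 1 ≤ 1 + (‖T‖ + 1) / n := by
    have : 0 ≤ (‖T‖ + 1) / n := by positivity
    linarith
  have hdiff : Φ (n : ℂ)⁻¹ - (1 + (n : ℂ)⁻¹ • T)
      = (n : ℂ)⁻¹ • ((n : ℂ) • (Φ (n : ℂ)⁻¹ - 1) - T) := by
    rw [smul_sub, smul_smul, inv_mul_cancel₀ hn0, one_smul]; abel
  have hexp : (1 + (‖T‖ + 1) / n) ^ n ≤ Real.exp (‖T‖ + 1) := by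
    calc (1 + (‖T‖ + 1) / n) ^ n ≤ Real.exp ((‖T‖ + 1) / n) ^ n := by
          gcongr
          rw [add_comm]
          exact Real.add_one_le_exp _
      _ = Real.exp (‖T‖ + 1) := by
          rw [← Real.exp_nat_mul]; congr 1; field_simp
  calc _ ≤ n * (1 + (‖T‖ + 1) / n) ^ n * ‖Φ (n : ℂ)⁻¹ - (1 + (n : ℂ)⁻¹ • T)‖ :=
        norm_pow_sub_pow_le hm ha hb' n
    _ = (1 + (‖T‖ + 1) / n) ^ n * ‖(n : ℂ) • (Φ (n : ℂ)⁻¹ - 1) - T‖ := by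
        rw [hdiff, norm_smul, norm_inv, Complex.norm_natCast]; field_simp
    _ ≤ _ := by gcongr

/-- The generator `i T` of a group of isometries is dissipative: `-i s T Z` is a limit of the
difference quotients `τ⁻¹ (Φ (-i s τ) Z - Z)`, and `Φ (-i s τ)` is an isometry. -/
theorem norm_le_norm_add_smul_generator {Φ : ℂ → V →L[ℂ] V} {T : V →L[ℂ] V} (h0 : Φ 0 = 1)
    (hΦ : HasDerivAt Φ T 0) (hiso : ∀ (s : ℝ) (Z : V), ‖Φ (s * Complex.I) Z‖ = ‖Z‖)
    (s : ℝ) (Z : V) : ‖Z‖ ≤ ‖Z + (s * Complex.I) • T Z‖ := by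
  set w : ℂ := -(s * Complex.I) with hw
  have hlin : HasDerivAt (fun τ : ℝ => (τ : ℂ) * w) w 0 := by
    simpa using (Complex.ofRealCLM.hasDerivAt (x := 0)).mul_const w
  have hΦZ : HasDerivAt (fun z => Φ z Z) (T Z) ((fun τ : ℝ => (τ : ℂ) * w) 0) := by
    have := (ContinuousLinearMap.apply ℂ V Z).hasFDerivAt.comp_hasDerivAt (0 : ℂ) hΦ
    simpa [Function.comp_def] using this
  have hu : HasDerivAt (fun τ : ℝ => Φ ((τ : ℂ) * w) Z) (w • T Z) 0 := by
    have := hΦZ.scomp (0 : ℝ) hlin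
    exact this
  have hlim : Tendsto (fun τ : ℝ => ‖Z - τ⁻¹ • (Φ ((τ : ℂ) * w) Z - Z)‖) (𝓝[>] 0)
      (𝓝 ‖Z + (s * Complex.I) • T Z‖) := by
    have := (hu.tendsto_slope_zero_right.const_sub Z).norm
    simpa [h0, hw] using this
  refine ge_of_tendsto hlim ?_
  filter_upwards [self_mem_nhdsWithin] with τ (hτ : 0 < τ)
  have hn : ‖Φ ((τ : ℂ) * w) Z‖ = ‖Z‖ := by
    have := hiso (-(τ * s)) Z
    rwa [show ((-(τ * s) : ℝ) : ℂ) * Complex.I = τ * w by rw [hw]; push_cast; ring] at this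
  have heq : Z - τ⁻¹ • (Φ ((τ : ℂ) * w) Z - Z)
      = (1 + τ⁻¹) • Z - τ⁻¹ • Φ ((τ : ℂ) * w) Z := by module
  have hpos : 0 < τ⁻¹ := inv_pos.2 hτ
  rw [heq]
  refine le_trans (le_of_eq ?_) (norm_sub_norm_le _ _)
  rw [norm_smul, norm_smul, hn, Real.norm_of_nonneg hpos.le, Real.norm_of_nonneg (by positivity)]
  ring

/-- If `Φ` is isometric on the imaginary axis, then `cosh T = (Φ 1 + Φ (-1)) / 2` does not
decrease norms. -/
theorem two_mul_norm_le_norm_add_neg {Φ : ℂ → V →L[ℂ] V} {T : V →L[ℂ] V} (h0 : Φ 0 = 1)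
    (hadd : ∀ z w, Φ (z + w) = Φ z * Φ w) (hΦ : HasDerivAt Φ T 0)
    (hiso : ∀ (s : ℝ) (Z : V), ‖Φ (s * Complex.I) Z‖ = ‖Z‖) (Z : V) :
    2 * ‖Z‖ ≤ ‖Φ 1 Z + Φ (-1) Z‖ := by
  have hpow : ∀ (z : ℂ) (n : ℕ), Φ z ^ n = Φ (n * z) := by
    intro z n
    induction n with
    | zero => simp [h0]
    | succ n ih => rw [pow_succ, ih, ← hadd]; congr 1; push_cast; ring
  have hneg : HasDerivAt (fun z => Φ (-z)) (-T) 0 := by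
    have := HasDerivAt.scomp (0 : ℂ) (h := fun z : ℂ => -z) (by simpa using hΦ)
      (hasDerivAt_neg (0 : ℂ))
    simpa [Function.comp_def] using this
  have h1 := tendsto_pow_sub_one_add_pow h0 hΦ
  have h2 := tendsto_pow_sub_one_add_pow (Φ := fun z => Φ (-z)) (by simpa using h0) hneg
  have hodd : Tendsto (fun k : ℕ => 2 * k + 1) atTop atTop :=
    tendsto_atTop_mono (fun k => by simp only [id]; omega) tendsto_id
  have hev := ((ContinuousLinearMap.apply ℂ V Z).continuous.tendsto _).comp
    ((h1.add h2).comp hodd)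
  have hev' : Tendsto (fun k : ℕ => ‖Φ 1 Z + Φ (-1) Z‖ +
      ‖(ContinuousLinearMap.apply ℂ V Z)
        ((Φ (((2 * k + 1 : ℕ) : ℂ))⁻¹ ^ (2 * k + 1) -
          (1 + (((2 * k + 1 : ℕ) : ℂ))⁻¹ • T) ^ (2 * k + 1)) +
        (Φ (-(((2 * k + 1 : ℕ) : ℂ))⁻¹) ^ (2 * k + 1) -
          (1 + (((2 * k + 1 : ℕ) : ℂ))⁻¹ • (-T)) ^ (2 * k + 1)))‖) atTop
      (𝓝 ‖Φ 1 Z + Φ (-1) Z‖) := by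
    simpa [Function.comp_def] using hev.norm.const_add ‖Φ 1 Z + Φ (-1) Z‖
  refine ge_of_tendsto' hev' fun k => ?_
  set n := 2 * k + 1 with hn
  have hn0 : (n : ℂ) ≠ 0 := by exact_mod_cast (by omega : n ≠ 0)
  have hT := norm_le_norm_add_smul_generator h0 hΦ hiso
  have hT' : ∀ (s : ℝ) (Z : V), ‖Z‖ ≤ ‖Z + (s * Complex.I) • ((n : ℂ)⁻¹ • T) Z‖ := by
    intro s Z
    have := hT (s * (n : ℝ)⁻¹) Z
    rw [smul_apply, smul_smul]
    convert this using 4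
    push_cast; ring
  refine (two_mul_norm_le_norm_pow_add_pow hT' ⟨k, hn⟩ Z).trans ?_
  refine le_trans (le_of_eq ?_) (norm_sub_le _ _)
  rw [hpow, hpow, mul_neg, mul_inv_cancel₀ hn0]
  congr 1
  simp only [ContinuousLinearMap.apply_apply, add_apply,
    sub_apply, smul_neg, ← sub_eq_add_neg]
  abel

end OneParameterGroup

/-! ### The norm ideal as a normed space, and the arithmetic-geometric mean inequality -/

namespace UnitarilyInvariantNorm

variable {H : Type*} [NormedAddCommGroup H] [InnerProductSpace ℂ H] [CompleteSpace H]
  (N : UnitarilyInvariantNorm H)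

/-- The norm ideal as a complex subspace of `B(H)`. -/
def submodule : Submodule ℂ (H →L[ℂ] H) where
  carrier := {X | X ∈ N.ideal}
  add_mem' := N.ideal.add_mem
  zero_mem' := N.ideal.zero_mem
  smul_mem' c X hX := by
    simpa using N.ideal.mul_mem_left (c • (1 : H →L[ℂ] H)) X hX

/-- The norm ideal, as a type synonym that carries the unitarily invariant norm instead of the
operator norm. It need not be complete. -/
def NormIdeal : Type _ := N.submodule

namespace NormIdeal

instance : AddCommGroup N.NormIdeal := inferInstanceAs (AddCommGroup N.submodule)

instance : Module ℂ N.NormIdeal := inferInstanceAs (Module ℂ N.submodule)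

variable {N}

/-- The inclusion of the norm ideal into `B(H)`. -/
def toOp : N.NormIdeal →ₗ[ℂ] (H →L[ℂ] H) := N.submodule.subtype

/-- An operator of the ideal, as an element of the normed space `NormIdeal`. -/
def of (X : H →L[ℂ] H) (hX : X ∈ N.ideal) : N.NormIdeal := ⟨X, hX⟩

@[simp] theorem toOp_of (X : H →L[ℂ] H) (hX : X ∈ N.ideal) : toOp (of X hX) = X := rfl

theorem toOp_mem (Z : N.NormIdeal) : toOp Z ∈ N.ideal := Subtype.property (p := (· ∈ N.ideal)) Z

theorem toOp_injective : Function.Injective (toOp : N.NormIdeal → (H →L[ℂ] H)) :=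
  Subtype.val_injective

noncomputable instance : NormedAddCommGroup N.NormIdeal :=
  AddGroupNorm.toNormedAddCommGroup
    { toFun := fun Z => N.norm (toOp Z)
      map_zero' := by simpa using N.norm_smul 0 0 N.ideal.zero_mem
      add_le' := fun Z W => by
        rw [map_add]; exact N.norm_add_le _ (toOp_mem Z) _ (toOp_mem W)
      neg' := fun Z => by
        rw [map_neg]; simpa using N.norm_smul (-1) _ (toOp_mem Z)
      eq_zero_of_map_eq_zero' := fun Z hZ => toOp_injective
        (by rw [N.eq_zero_of_norm_eq_zero _ (toOp_mem Z) hZ, map_zero]) }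

theorem norm_def (Z : N.NormIdeal) : ‖Z‖ = N.norm (toOp Z) := rfl

@[simp] theorem norm_of (X : H →L[ℂ] H) (hX : X ∈ N.ideal) :
    ‖(of X hX : N.NormIdeal)‖ = N.norm X := rfl

noncomputable instance : NormedSpace ℂ N.NormIdeal where
  norm_smul_le c Z := by
    rw [norm_def, map_smul, N.norm_smul c _ (toOp_mem Z), norm_def]

theorem norm_unitary_mul {U : H →L[ℂ] H} (hU : U ∈ unitary (H →L[ℂ] H)) {X : H →L[ℂ] H}
    (hX : X ∈ N.ideal) : N.norm (U * X) = N.norm X := by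
  simpa using N.norm_unitary_mul_mul_unitary U hU 1 (one_mem _) X hX

theorem norm_mul_unitary {U : H →L[ℂ] H} (hU : U ∈ unitary (H →L[ℂ] H)) {X : H →L[ℂ] H}
    (hX : X ∈ N.ideal) : N.norm (X * U) = N.norm X := by
  simpa using N.norm_unitary_mul_mul_unitary 1 (one_mem _) U hU X hX

/-- Left multiplication by a bounded operator on the ideal, as a bilinear map. -/
def mulLeftₗ : (H →L[ℂ] H) →ₗ[ℂ] N.NormIdeal →ₗ[ℂ] N.NormIdeal :=
  LinearMap.mk₂ ℂ (fun a Z => of (a * toOp Z) (N.ideal.mul_mem_left a _ (toOp_mem Z)))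
    (fun _ _ _ => toOp_injective (add_mul _ _ _))
    (fun _ _ _ => toOp_injective (smul_mul_assoc _ _ _))
    (fun a Z W => toOp_injective (by simp [mul_add]))
    (fun c a Z => toOp_injective (by simp))

/-- Right multiplication by a bounded operator on the ideal, as a bilinear map. -/
def mulRightₗ : (H →L[ℂ] H) →ₗ[ℂ] N.NormIdeal →ₗ[ℂ] N.NormIdeal :=
  LinearMap.mk₂ ℂ (fun b Z => of (toOp Z * b) (N.ideal.mul_mem_right _ b (toOp_mem Z)))
    (fun _ _ _ => toOp_injective (mul_add _ _ _))
    (fun _ _ _ => toOp_injective (mul_smul_comm _ _ _))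
    (fun a Z W => toOp_injective (by simp [add_mul]))
    (fun c a Z => toOp_injective (by simp))

/-- The constant `2` comes from writing `a` as a combination of four unitaries with coefficients
of modulus at most `‖a‖ / 2`; only the boundedness matters. -/
theorem norm_le_two_mul_of_unitary (f : (H →L[ℂ] H) →ₗ[ℂ] N.NormIdeal →ₗ[ℂ] N.NormIdeal)
    (hf : ∀ U ∈ unitary (H →L[ℂ] H), ∀ Z, ‖f U Z‖ = ‖Z‖) (a : H →L[ℂ] H) (Z : N.NormIdeal) :
    ‖f a Z‖ ≤ 2 * ‖a‖ * ‖Z‖ := by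
  obtain ⟨u, c, ha, hc⟩ := CStarAlgebra.exists_sum_four_unitary a
  have h : f a Z = ∑ i, c i • f (u i) Z := by
    conv_lhs => rw [ha]
    simp [map_sum, LinearMap.sum_apply]
  rw [h]
  calc ‖∑ i, c i • f (u i) Z‖ ≤ ∑ i, ‖c i • f (u i) Z‖ := norm_sum_le _ _
    _ ≤ ∑ _i : Fin 4, ‖a‖ / 2 * ‖Z‖ := by
        refine Finset.sum_le_sum fun i _ => ?_
        rw [_root_.norm_smul, hf _ (u i).2]
        gcongr
        exact hc i
    _ = 2 * ‖a‖ * ‖Z‖ := by simp; ring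

/-- Left multiplication `a ↦ (Z ↦ a Z)` as a bounded linear map into the bounded operators on the
ideal. -/
noncomputable def mulLeft : (H →L[ℂ] H) →L[ℂ] N.NormIdeal →L[ℂ] N.NormIdeal :=
  mulLeftₗ.mkContinuous₂ 2
    (norm_le_two_mul_of_unitary _ fun _ hU Z => norm_unitary_mul hU (toOp_mem Z))

/-- Right multiplication `b ↦ (Z ↦ Z b)` as a bounded linear map into the bounded operators on the
ideal. -/
noncomputable def mulRight : (H →L[ℂ] H) →L[ℂ] N.NormIdeal →L[ℂ] N.NormIdeal :=
  mulRightₗ.mkContinuous₂ 2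
    (norm_le_two_mul_of_unitary _ fun _ hU Z => norm_mul_unitary hU (toOp_mem Z))

@[simp] theorem toOp_mulLeft (a : H →L[ℂ] H) (Z : N.NormIdeal) :
    toOp (mulLeft a Z) = a * toOp Z := rfl

@[simp] theorem toOp_mulRight (b : H →L[ℂ] H) (Z : N.NormIdeal) :
    toOp (mulRight b Z) = toOp Z * b := rfl

/-- The complex one-parameter group `z ↦ (Z ↦ exp (z S) Z exp (-z K))` on the ideal. -/
noncomputable def expFlow (S K : H →L[ℂ] H) (z : ℂ) : N.NormIdeal →L[ℂ] N.NormIdeal :=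
  mulLeft (NormedSpace.exp (z • S)) * mulRight (NormedSpace.exp ((-z) • K))

@[simp] theorem toOp_expFlow (S K : H →L[ℂ] H) (z : ℂ) (Z : N.NormIdeal) :
    toOp (expFlow S K z Z) =
      NormedSpace.exp (z • S) * (toOp Z * NormedSpace.exp ((-z) • K)) := rfl

theorem exp_add_smul (S : H →L[ℂ] H) (z w : ℂ) :
    NormedSpace.exp ((z + w) • S) = NormedSpace.exp (z • S) * NormedSpace.exp (w • S) := by
  let _ : NormedAlgebra ℚ (H →L[ℂ] H) := .restrictScalars ℚ ℂ _
  rw [add_smul]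
  exact NormedSpace.exp_add_of_commute (((Commute.refl S).smul_left z).smul_right w)

theorem expFlow_zero (S K : H →L[ℂ] H) : (expFlow S K 0 : N.NormIdeal →L[ℂ] N.NormIdeal) = 1 := by
  ext1 Z
  apply toOp_injective
  simp

theorem expFlow_add (S K : H →L[ℂ] H) (z w : ℂ) :
    (expFlow S K (z + w) : N.NormIdeal →L[ℂ] N.NormIdeal) = expFlow S K z * expFlow S K w := by
  ext1 Z
  apply toOp_injective
  change _ = toOp (expFlow S K z (expFlow S K w Z))
  simp only [toOp_expFlow]
  rw [neg_add_rev, exp_add_smul, exp_add_smul]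
  simp only [mul_assoc]

theorem hasDerivAt_expFlow_zero (S K : H →L[ℂ] H) :
    HasDerivAt (expFlow S K : ℂ → N.NormIdeal →L[ℂ] N.NormIdeal) (mulLeft S - mulRight K) 0 := by
  have hS : HasDerivAt (fun z : ℂ => NormedSpace.exp (z • S)) S 0 := by
    simpa using hasDerivAt_exp_smul_const (𝕂 := ℂ) S (0 : ℂ)
  have hK : HasDerivAt (fun z : ℂ => NormedSpace.exp ((-z) • K)) (-K) 0 := by
    have := HasDerivAt.scomp (0 : ℂ) (h := fun z : ℂ => -z)
      (hasDerivAt_exp_smul_const (𝕂 := ℂ) K (-0 : ℂ)) (hasDerivAt_neg (0 : ℂ))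
    simpa [Function.comp_def] using this
  have h1 := (mulLeft (N := N)).hasFDerivAt.comp_hasDerivAt (0 : ℂ) hS
  have h2 := (mulRight (N := N)).hasFDerivAt.comp_hasDerivAt (0 : ℂ) hK
  have h3 := h1.mul h2
  convert! h3 using 1
  ext1 Z
  apply toOp_injective
  simp [sub_eq_add_neg]

theorem norm_expFlow_mul_I {S K : H →L[ℂ] H} (hS : IsSelfAdjoint S) (hK : IsSelfAdjoint K)
    (s : ℝ) (Z : N.NormIdeal) : ‖expFlow S K (s * Complex.I) Z‖ = ‖Z‖ := by
  have hu : ∀ (r : ℝ) {T : H →L[ℂ] H}, IsSelfAdjoint T →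
      NormedSpace.exp (((r : ℂ) * Complex.I) • T) ∈ unitary (H →L[ℂ] H) := by
    let _ : NormedAlgebra ℚ (H →L[ℂ] H) := .restrictScalars ℚ ℂ _
    intro r T hT
    apply NormedSpace.exp_mem_unitary_of_mem_skewAdjoint
    exact hT.smul_mem_skewAdjoint (by simp [skewAdjoint.mem_iff])
  rw [norm_def, toOp_expFlow, ← mul_assoc, norm_def]
  refine N.norm_unitary_mul_mul_unitary _ (hu s hS) _ ?_ _ (toOp_mem Z)
  simpa using hu (-s) hK

end NormIdeal

open NormIdeal in
/-- With `C = exp S` and `D = exp K`, apply `two_mul_norm_le_norm_add_neg` to the group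
`Z ↦ exp (z S) Z exp (-z K)` at `Z = C Y D`: its values at `1` and `-1` are `C ^ 2 Y` and
`Y D ^ 2`. -/
theorem two_mul_norm_mul_mul_le_of_isStrictlyPositive {C D Y : H →L[ℂ] H}
    (hC : IsStrictlyPositive C) (hD : IsStrictlyPositive D) (hY : Y ∈ N.ideal) :
    2 * N.norm (C * Y * D) ≤ N.norm (C ^ 2 * Y + Y * D ^ 2) := by
  let _ : NormedAlgebra ℚ (H →L[ℂ] H) := .restrictScalars ℚ ℂ _
  have hexpC := CFC.exp_log C hC
  have hexpD := CFC.exp_log D hD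
  have hinv : ∀ S : H →L[ℂ] H, NormedSpace.exp (-S) * NormedSpace.exp S = 1 := by
    intro S
    rw [← NormedSpace.exp_add_of_commute (Commute.refl S).neg_left]; simp
  have hinv' : ∀ S : H →L[ℂ] H, NormedSpace.exp S * NormedSpace.exp (-S) = 1 := by
    intro S
    rw [← NormedSpace.exp_add_of_commute (Commute.refl S).neg_right]; simp
  have hZ : C * Y * D ∈ N.ideal := N.ideal.mul_mem_right _ _ (N.ideal.mul_mem_left _ _ hY)
  have key := two_mul_norm_le_norm_add_neg (expFlow_zero (N := N) (CFC.log C) (CFC.log D))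
    (expFlow_add _ _) (hasDerivAt_expFlow_zero _ _)
    (norm_expFlow_mul_I IsSelfAdjoint.log IsSelfAdjoint.log) (of (C * Y * D) hZ)
  have hC' : NormedSpace.exp (-CFC.log C) * C = 1 := by
    have := hinv (CFC.log C)
    rwa [hexpC] at this
  have hD' : D * NormedSpace.exp (-CFC.log D) = 1 := by
    have := hinv' (CFC.log D)
    rwa [hexpD] at this
  rw [norm_of, norm_def, map_add, toOp_expFlow, toOp_expFlow, toOp_of] at key
  simp only [one_smul, neg_neg, neg_smul, hexpC, hexpD] at key
  refine key.trans_eq (congrArg N.norm ?_)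
  congr 1
  · rw [mul_assoc (C * Y), hD', mul_one, ← mul_assoc, sq]
  · rw [← mul_assoc, ← mul_assoc, ← mul_assoc, hC', one_mul, mul_assoc, sq]

open NormIdeal in
/-- The arithmetic-geometric mean inequality for an arbitrary unitarily invariant norm. -/
theorem two_mul_norm_mul_mul_le {C D Y : H →L[ℂ] H} (hC : 0 ≤ C) (hD : 0 ≤ D)
    (hY : Y ∈ N.ideal) :
    2 * N.norm (C * Y * D) ≤ N.norm (C ^ 2 * Y + Y * D ^ 2) := by
  let Z : N.NormIdeal := of Y hY
  -- the strictly positive case applied to `C + ε` and `D + ε`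
  have h1 : Continuous fun ε : ℝ =>
      ‖mulLeft (C + (ε : ℂ) • 1) (mulRight (D + (ε : ℂ) • 1) Z)‖ := by fun_prop
  have h2 : Continuous fun ε : ℝ =>
      ‖mulLeft ((C + (ε : ℂ) • 1) ^ 2) Z + mulRight ((D + (ε : ℂ) • 1) ^ 2) Z‖ := by fun_prop
  have hpos : ∀ {S : H →L[ℂ] H}, 0 ≤ S → ∀ {ε : ℝ}, 0 < ε →
      IsStrictlyPositive (S + (ε : ℂ) • (1 : H →L[ℂ] H)) := by
    intro S hS ε hε
    have h1 : IsStrictlyPositive (algebraMap ℝ (H →L[ℂ] H) ε) := by grind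
    have h2 : (ε : ℂ) • (1 : H →L[ℂ] H) = algebraMap ℝ (H →L[ℂ] H) ε := by
      rw [Algebra.algebraMap_eq_smul_one, Complex.coe_smul]
    rw [h2]
    exact IsStrictlyPositive.nonneg_add hS h1
  have hle : ∀ᶠ ε : ℝ in 𝓝[>] 0,
      2 * ‖mulLeft (C + (ε : ℂ) • 1) (mulRight (D + (ε : ℂ) • 1) Z)‖ ≤
      ‖mulLeft ((C + (ε : ℂ) • 1) ^ 2) Z + mulRight ((D + (ε : ℂ) • 1) ^ 2) Z‖ := by
    filter_upwards [self_mem_nhdsWithin] with ε hε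
    have := N.two_mul_norm_mul_mul_le_of_isStrictlyPositive (hpos hC hε) (hpos hD hε) hY
    rw [mul_assoc] at this
    exact this
  have := le_of_tendsto_of_tendsto ((h1.const_mul 2).tendsto 0 |>.mono_left nhdsWithin_le_nhds)
    (h2.tendsto 0 |>.mono_left nhdsWithin_le_nhds) hle
  simp only [Complex.ofReal_zero, zero_smul, add_zero] at this
  rw [mul_assoc]
  exact this

end UnitarilyInvariantNorm

/-! ### Convex functions on an interval -/

section ConvexFunctions

variable {f : ℝ → ℝ} {a b : ℝ}

/-- A continuous midpoint convex function is convex. -/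
theorem convexOn_Icc_of_midpoint_le (hc : ContinuousOn f (Icc a b))
    (hm : ∀ x ∈ Icc a b, ∀ y ∈ Icc a b, f ((x + y) / 2) ≤ (f x + f y) / 2) :
    ConvexOn ℝ (Icc a b) f := by
  refine LinearOrder.convexOn_of_lt (convex_Icc a b) fun x hx y hy hxy s t hs ht hst => ?_
  have hsub : Icc x y ⊆ Icc a b := Icc_subset_Icc hx.1 hy.2
  set k := (f y - f x) / (y - x)
  have hkxy : k * (y - x) = f y - f x := div_mul_cancel₀ _ (by linarith)
  let g : ℝ → ℝ := fun z => f z - (f x + k * (z - x))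
  have hgc : ContinuousOn g (Icc x y) := (hc.mono hsub).sub (by fun_prop)
  have hgx : g x = 0 := by simp [g]
  have hgy : g y = 0 := by simp only [g]; linarith
  have hgm : ∀ u ∈ Icc x y, ∀ v ∈ Icc x y, g ((u + v) / 2) ≤ (g u + g v) / 2 := by
    intro u hu v hv
    have := hm u (hsub hu) v (hsub hv)
    simp only [g]
    linarith
  obtain ⟨m, hmI, hmax⟩ := isCompact_Icc.exists_isMaxOn (nonempty_Icc.2 hxy.le) hgc
  have hg0 : g m ≤ 0 := by
    by_contra! hpos
    -- the leftmost maximizer `c` violates the midpoint inequality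
    have hcl : IsCompact (Icc x y ∩ g ⁻¹' {g m}) :=
      isCompact_Icc.of_isClosed_subset
        (hgc.preimage_isClosed_of_isClosed isClosed_Icc isClosed_singleton) inter_subset_left
    obtain ⟨c, ⟨hcI, hcm⟩, hleast⟩ := hcl.exists_isLeast ⟨m, hmI, rfl⟩
    have hcm : g c = g m := hcm
    have hxc : x < c := lt_of_le_of_ne hcI.1 (by rintro rfl; linarith)
    have hcy : c < y := lt_of_le_of_ne hcI.2 (by rintro rfl; linarith)
    obtain ⟨δ, hδ, hδ'⟩ : ∃ δ, 0 < δ ∧ δ ≤ min (c - x) (y - c) :=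
      ⟨_, lt_min (by linarith) (by linarith), le_rfl⟩
    have hδ1 := hδ'.trans (min_le_left _ _)
    have hδ2 := hδ'.trans (min_le_right _ _)
    have h1 : c - δ ∈ Icc x y := ⟨by linarith, by linarith⟩
    have h2 : c + δ ∈ Icc x y := ⟨by linarith, by linarith⟩
    have h3 := hgm _ h1 _ h2
    rw [show (c - δ + (c + δ)) / 2 = c by ring] at h3
    have h4 : g (c - δ) < g m := by
      refine lt_of_le_of_ne (hmax h1) fun h => ?_
      linarith [hleast ⟨h1, h⟩]
    have h5 : g (c + δ) ≤ g m := hmax h2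
    linarith
  have hz : s * x + t * y ∈ Icc x y :=
    convex_Icc x y (left_mem_Icc.2 hxy.le) (right_mem_Icc.2 hxy.le) hs.le ht.le hst
  have h := (hmax hz).trans hg0
  have hzx : s * x + t * y - x = t * (y - x) := by
    rw [show s = 1 - t by linarith]; ring
  have hlin : f x + k * (s * x + t * y - x) = s * f x + t * f y := by
    rw [hzx, show k * (t * (y - x)) = t * (k * (y - x)) by ring, hkxy,
      show s = 1 - t by linarith]
    ring
  simp only [g] at h
  simp only [smul_eq_mul]
  linarith

/-- The Hermite-Hadamard inequality. -/
theorem ConvexOn.midpoint_le_intervalMean (hf : ConvexOn ℝ (Icc a b) f)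
    (hc : ContinuousOn f (Icc a b)) (hab : a ≤ b) :
    f ((a + b) / 2) ≤ intervalMean f a b ∧ intervalMean f a b ≤ (f a + f b) / 2 := by
  rcases hab.eq_or_lt with rfl | hlt
  · simp [intervalMean]
  have hi : IntervalIntegrable f volume a b := hc.intervalIntegrable_of_Icc hab
  have hmaps : MapsTo (fun x => a + b - x) (Icc a b) (Icc a b) :=
    fun x hx => ⟨by linarith [hx.2], by linarith [hx.1]⟩
  have hi' : IntervalIntegrable (fun x => f (a + b - x)) volume a b :=
    (hc.comp (by fun_prop) hmaps).intervalIntegrable_of_Icc hab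
  -- symmetrize the integrand about the midpoint
  have hsymm : ∫ x in a..b, (f x + f (a + b - x)) = 2 * ∫ x in a..b, f x := by
    rw [intervalIntegral.integral_add hi hi', intervalIntegral.integral_comp_sub_left]
    simp only [add_sub_cancel_right, add_sub_cancel_left]
    ring
  have hpt : ∀ x ∈ Icc a b, 2 * f ((a + b) / 2) ≤ f x + f (a + b - x) ∧
      f x + f (a + b - x) ≤ f a + f b := by
    intro x hx
    constructor
    · have := hf.2 hx (hmaps hx) (show (0 : ℝ) ≤ 1 / 2 by norm_num)
        (show (0 : ℝ) ≤ 1 / 2 by norm_num) (by norm_num)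
      simp only [smul_eq_mul] at this
      rw [show 1 / 2 * x + 1 / 2 * (a + b - x) = (a + b) / 2 by ring] at this
      linarith
    · have hba : 0 < b - a := by linarith
      have hd : (b - x) / (b - a) + (x - a) / (b - a) = 1 := by field_simp; ring
      have h0 : 0 ≤ (b - x) / (b - a) := div_nonneg (by linarith [hx.2]) hba.le
      have h1 : 0 ≤ (x - a) / (b - a) := div_nonneg (by linarith [hx.1]) hba.le
      have ha : a ∈ Icc a b := left_mem_Icc.2 hab
      have hb : b ∈ Icc a b := right_mem_Icc.2 hab
      have e1 := hf.2 ha hb h0 h1 hd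
      have e2 := hf.2 ha hb h1 h0 (by rw [add_comm]; exact hd)
      simp only [smul_eq_mul] at e1 e2
      rw [show (b - x) / (b - a) * a + (x - a) / (b - a) * b = x by field_simp; ring] at e1
      rw [show (x - a) / (b - a) * a + (b - x) / (b - a) * b = a + b - x by field_simp; ring] at e2
      have hd' : (x - a) / (b - a) = 1 - (b - x) / (b - a) := by linarith
      rw [hd'] at e1 e2
      linarith
  have hlow : (b - a) * (2 * f ((a + b) / 2)) ≤ 2 * ∫ x in a..b, f x := by
    rw [← hsymm, ← smul_eq_mul (b - a), ← intervalIntegral.integral_const]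
    exact intervalIntegral.integral_mono_on hab intervalIntegrable_const (hi.add hi')
      fun x hx => (hpt x hx).1
  have hup : 2 * ∫ x in a..b, f x ≤ (b - a) * (f a + f b) := by
    rw [← hsymm, ← smul_eq_mul (b - a), ← intervalIntegral.integral_const]
    exact intervalIntegral.integral_mono_on hab (hi.add hi') intervalIntegrable_const
      fun x hx => (hpt x hx).2
  have hba : 0 < b - a := by linarith
  rw [intervalMean, if_neg hlt.ne, one_div, inv_mul_eq_div, le_div_iff₀ hba, div_le_iff₀ hba]
  constructor <;> linarith

/-- The means are squeezed between the two Hermite-Hadamard bounds. -/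
theorem ConvexOn.tendsto_mean_right (hf : ConvexOn ℝ (Icc 0 1) f)
    (hc : ContinuousOn f (Icc 0 1)) :
    Tendsto (fun α => 1 / α * ∫ ν in (0 : ℝ)..α, f ν) (𝓝[>] 0) (𝓝 (f 0)) := by
  have h0 : ContinuousWithinAt f (Icc 0 1) 0 := hc 0 (by simp)
  have hev : ∀ᶠ α : ℝ in 𝓝[>] 0, α ∈ Ioc (0 : ℝ) 1 := Ioc_mem_nhdsGT one_pos
  have hid : Tendsto (fun α : ℝ => α) (𝓝[>] 0) (𝓝 0) := nhdsWithin_le_nhds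
  have h1 : Tendsto (fun α : ℝ => f ((0 + α) / 2)) (𝓝[>] 0) (𝓝 (f 0)) := by
    refine h0.tendsto.comp (tendsto_nhdsWithin_iff.2 ⟨?_, ?_⟩)
    · simpa using (hid.const_add 0).div_const 2
    · filter_upwards [hev] with α hα
      exact ⟨by linarith [hα.1], by linarith [hα.2]⟩
  have h2 : Tendsto (fun α : ℝ => (f 0 + f α) / 2) (𝓝[>] 0) (𝓝 (f 0)) := by
    have : Tendsto (fun α : ℝ => f α) (𝓝[>] 0) (𝓝 (f 0)) := by
      refine h0.tendsto.comp (tendsto_nhdsWithin_iff.2 ⟨hid, ?_⟩)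
      filter_upwards [hev] with α hα
      exact ⟨hα.1.le, hα.2⟩
    simpa using (this.const_add (f 0)).div_const 2
  have hmean : ∀ α ∈ Ioc (0 : ℝ) 1, f ((0 + α) / 2) ≤ 1 / α * ∫ ν in (0 : ℝ)..α, f ν ∧
      1 / α * ∫ ν in (0 : ℝ)..α, f ν ≤ (f 0 + f α) / 2 := by
    intro α hα
    have hsub : Icc 0 α ⊆ Icc (0 : ℝ) 1 := Icc_subset_Icc_right hα.2
    have := (hf.subset hsub (convex_Icc _ _)).midpoint_le_intervalMean (hc.mono hsub) hα.1.le
    rwa [intervalMean, if_neg hα.1.ne, sub_zero] at this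
  exact tendsto_of_tendsto_of_tendsto_of_le_of_le' h1 h2
    (hev.mono fun α hα => (hmean α hα).1) (hev.mono fun α hα => (hmean α hα).2)

theorem tendsto_mean_left_of_symm (hsymm : ∀ x, f (1 - x) = f x)
    (h : Tendsto (fun α => 1 / α * ∫ ν in (0 : ℝ)..α, f ν) (𝓝[>] 0) (𝓝 (f 0))) :
    Tendsto (fun α => 1 / (1 - α) * ∫ ν in α..(1 : ℝ), f ν) (𝓝[<] 1) (𝓝 (f 1)) := by
  have hmap : Tendsto (fun α : ℝ => 1 - α) (𝓝[<] 1) (𝓝[>] 0) := by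
    refine tendsto_nhdsWithin_iff.2 ⟨?_, ?_⟩
    · have : Tendsto (fun α : ℝ => α) (𝓝[<] 1) (𝓝 1) := nhdsWithin_le_nhds
      simpa using this.const_sub 1
    · filter_upwards [self_mem_nhdsWithin] with α (hα : α < 1)
      exact sub_pos.2 hα
  have h01 : f 0 = f 1 := by rw [← hsymm 0, sub_zero]
  rw [← h01]
  refine (h.comp hmap).congr fun α => ?_
  simp only [Function.comp_apply]
  congr 1
  calc ∫ ν in (0 : ℝ)..(1 - α), f ν = ∫ ν in (0 : ℝ)..(1 - α), f (1 - ν) := by simp only [hsymm]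
    _ = ∫ ν in α..(1 : ℝ), f ν := by rw [intervalIntegral.integral_comp_sub_left]; simp

theorem ConvexOn.antitoneOn_of_symm (hf : ConvexOn ℝ (Icc 0 1) f) (hsymm : ∀ x, f (1 - x) = f x) :
    AntitoneOn f (Icc 0 (1 / 2)) := by
  intro x hx y hy hxy
  have h := hf.le_max_of_mem_Icc (x := x) (y := 1 - x) (z := y) ⟨hx.1, by linarith [hx.2]⟩
    ⟨by linarith [hx.2], by linarith [hx.1]⟩ ⟨hxy, by linarith [hx.2, hy.2]⟩
  simpa [hsymm] using h

end ConvexFunctions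

/-! ### Real powers of positive operators -/

section RealPowers

open scoped NNReal

variable {H : Type*} [NormedAddCommGroup H] [InnerProductSpace ℂ H] [CompleteSpace H]

theorem rpow_add_of_pos (A : H →L[ℂ] H) {p q : ℝ} (hp : 0 < p) (hq : 0 < q) :
    A ^ (p + q) = A ^ p * A ^ q := by
  lift p to ℝ≥0 using hp.le
  lift q to ℝ≥0 using hq.le
  norm_cast at hp hq
  rw [← NNReal.coe_add, ← CFC.nnrpow_eq_rpow hp, ← CFC.nnrpow_eq_rpow hq,
    ← CFC.nnrpow_eq_rpow (add_pos hp hq), CFC.nnrpow_add hp hq]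

theorem rpow_sq_of_pos (A : H →L[ℂ] H) {p : ℝ} (hp : 0 < p) : (A ^ p) ^ 2 = A ^ (p + p) := by
  rw [sq, rpow_add_of_pos A hp hp]

/-- At `p = 0` this fails in general, since `0 ^ 0 = 1`. -/
theorem continuousOn_rpow_exponent (A : H →L[ℂ] H) :
    ContinuousOn (fun p : ℝ => A ^ p) (Ioi 0) := by
  intro p hp
  refine continuousWithinAt_cfc_fun ?_ ?_
  · rw [Metric.tendstoUniformlyOn_iff]
    intro ε hε
    have hcont : ContinuousOn (Function.uncurry fun (p : ℝ) (x : ℝ≥0) => x ^ p)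
        (Ioi 0 ×ˢ spectrum ℝ≥0 A) := by
      rintro ⟨q, x⟩ ⟨hq, -⟩
      have : ContinuousAt (fun z : ℝ≥0 × ℝ => z.1 ^ z.2) (x, q) :=
        NNReal.continuousAt_rpow (Or.inr hq)
      exact (this.comp (f := fun w : ℝ × ℝ≥0 => (w.2, w.1)) (x := (q, x))
        (by fun_prop)).continuousWithinAt
    have hK : IsCompact (spectrum ℝ≥0 A) := spectrum.isCompact_nnreal A
    obtain ⟨v, hv, hvε⟩ := hK.mem_uniformity_of_prod hcont hp (Metric.dist_mem_uniformity hε)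
    filter_upwards [hv] with q hq x hx
    rw [dist_comm]
    exact hvε q hq x hx
  · filter_upwards [self_mem_nhdsWithin] with q hq
    exact (NNReal.continuous_rpow_const (le_of_lt hq)).continuousOn

end RealPowers

/-! ### Heinz sums -/

section Heinz

variable {H : Type*} [NormedAddCommGroup H] [InnerProductSpace ℂ H] [CompleteSpace H]
  {A B X : H →L[ℂ] H}

theorem heinzSum_comm (A B X : H →L[ℂ] H) (p q : ℝ) :
    heinzSum A B X p q = heinzSum A B X q p := add_comm _ _

namespace UnitarilyInvariantNorm

variable (N : UnitarilyInvariantNorm H)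

theorem mul_mul_mem (hX : X ∈ N.ideal) (C D : H →L[ℂ] H) : C * X * D ∈ N.ideal :=
  N.ideal.mul_mem_right _ _ (N.ideal.mul_mem_left _ _ hX)

theorem heinzSum_mem (hX : X ∈ N.ideal) (p q : ℝ) : heinzSum A B X p q ∈ N.ideal :=
  N.ideal.add_mem (N.mul_mul_mem hX _ _) (N.mul_mul_mem hX _ _)

/-- The arithmetic-geometric mean inequality with `C = A ^ δ`, `D = B ^ δ` and
`Y = heinzSum A B X (p - δ) (q - δ)`. The conditions on `δ` keep all exponents positive, so no
inverse is needed. -/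
theorem two_mul_norm_heinzSum_le (hX : X ∈ N.ideal) {p q δ : ℝ} (hδ : 0 < δ) (hp : δ < p)
    (hq : δ < q) :
    2 * N.norm (heinzSum A B X p q) ≤
      N.norm (heinzSum A B X (p + δ) (q - δ)) + N.norm (heinzSum A B X (p - δ) (q + δ)) := by
  have h := N.two_mul_norm_mul_mul_le (C := A ^ δ) (D := B ^ δ) CFC.rpow_nonneg CFC.rpow_nonneg
    (N.heinzSum_mem (A := A) (B := B) hX (p - δ) (q - δ))
  have hp' : 0 < p - δ := by linarith
  have hq' : 0 < q - δ := by linarith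
  have e1 : A ^ δ * heinzSum A B X (p - δ) (q - δ) * B ^ δ = heinzSum A B X p q := by
    have hAp : A ^ p = A ^ δ * A ^ (p - δ) := by rw [← rpow_add_of_pos A hδ hp']; congr 1; ring
    have hAq : A ^ q = A ^ δ * A ^ (q - δ) := by rw [← rpow_add_of_pos A hδ hq']; congr 1; ring
    have hBp : B ^ p = B ^ (p - δ) * B ^ δ := by rw [← rpow_add_of_pos B hp' hδ]; congr 1; ring
    have hBq : B ^ q = B ^ (q - δ) * B ^ δ := by rw [← rpow_add_of_pos B hq' hδ]; congr 1; ring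
    simp only [heinzSum, hAp, hAq, hBp, hBq, mul_add, add_mul, mul_assoc]
  have e2 : (A ^ δ) ^ 2 * heinzSum A B X (p - δ) (q - δ)
      + heinzSum A B X (p - δ) (q - δ) * (B ^ δ) ^ 2
      = heinzSum A B X (p + δ) (q - δ) + heinzSum A B X (p - δ) (q + δ) := by
    have hδ2 : 0 < δ + δ := by linarith
    have hAp : A ^ (p + δ) = A ^ (δ + δ) * A ^ (p - δ) := by
      rw [← rpow_add_of_pos A hδ2 hp']; congr 1; ring
    have hAq : A ^ (q + δ) = A ^ (δ + δ) * A ^ (q - δ) := by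
      rw [← rpow_add_of_pos A hδ2 hq']; congr 1; ring
    have hBp : B ^ (p + δ) = B ^ (p - δ) * B ^ (δ + δ) := by
      rw [← rpow_add_of_pos B hp' hδ2]; congr 1; ring
    have hBq : B ^ (q + δ) = B ^ (q - δ) * B ^ (δ + δ) := by
      rw [← rpow_add_of_pos B hq' hδ2]; congr 1; ring
    rw [rpow_sq_of_pos A hδ, rpow_sq_of_pos B hδ]
    simp only [heinzSum, hAp, hAq, hBp, hBq, mul_add, add_mul, mul_assoc]
    abel
  rw [e1, e2] at h
  exact h.trans (N.norm_add_le _ (N.heinzSum_mem hX _ _) _ (N.heinzSum_mem hX _ _))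

open NormIdeal in
theorem continuousOn_norm_heinzSum (hX : X ∈ N.ideal) :
    ContinuousOn (fun ν : ℝ => N.norm (heinzSum A B X (ν + 1 / 2) (3 / 2 - ν))) (Icc 0 1) := by
  let Z : N.NormIdeal := of X hX
  have hp : MapsTo (fun ν : ℝ => ν + 1 / 2) (Icc 0 1) (Ioi 0) :=
    fun ν hν => by simp only [mem_Ioi]; linarith [hν.1]
  have hq : MapsTo (fun ν : ℝ => 3 / 2 - ν) (Icc 0 1) (Ioi 0) :=
    fun ν hν => by simp only [mem_Ioi]; linarith [hν.2]
  have hpow : ∀ S : H →L[ℂ] H, ContinuousOn (fun ν : ℝ => S ^ (ν + 1 / 2)) (Icc 0 1) ∧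
      ContinuousOn (fun ν : ℝ => S ^ (3 / 2 - ν)) (Icc 0 1) := fun S =>
    ⟨(continuousOn_rpow_exponent S).comp (by fun_prop) hp,
      (continuousOn_rpow_exponent S).comp (by fun_prop) hq⟩
  have hterm : ∀ C D : ℝ → H →L[ℂ] H, ContinuousOn C (Icc 0 1) → ContinuousOn D (Icc 0 1) →
      ContinuousOn (fun ν => mulRight (D ν) (mulLeft (C ν) Z)) (Icc 0 1) := fun C D hC hD =>
    ((mulRight (N := N)).continuous.comp_continuousOn hD).clm_apply
      (((mulLeft (N := N)).continuous.comp_continuousOn hC).clm_apply continuousOn_const)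
  exact ((hterm _ _ (hpow A).1 (hpow B).2).add (hterm _ _ (hpow A).2 (hpow B).1)).norm

theorem convexOn_norm_heinzSum (hX : X ∈ N.ideal) :
    ConvexOn ℝ (Icc 0 1) fun ν : ℝ => N.norm (heinzSum A B X (ν + 1 / 2) (3 / 2 - ν)) := by
  refine convexOn_Icc_of_midpoint_le (N.continuousOn_norm_heinzSum hX) ?_
  have hlt : ∀ x ∈ Icc (0 : ℝ) 1, ∀ y ∈ Icc (0 : ℝ) 1, x < y →
      N.norm (heinzSum A B X ((x + y) / 2 + 1 / 2) (3 / 2 - (x + y) / 2)) ≤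
        (N.norm (heinzSum A B X (x + 1 / 2) (3 / 2 - x)) +
          N.norm (heinzSum A B X (y + 1 / 2) (3 / 2 - y))) / 2 := by
    intro x hx y hy hxy
    have h := N.two_mul_norm_heinzSum_le (A := A) (B := B) hX (p := (x + y) / 2 + 1 / 2)
      (q := 3 / 2 - (x + y) / 2) (δ := (y - x) / 2) (by linarith) (by linarith [hx.1])
      (by linarith [hy.2])
    rw [show (x + y) / 2 + 1 / 2 + (y - x) / 2 = y + 1 / 2 by ring,
      show (x + y) / 2 + 1 / 2 - (y - x) / 2 = x + 1 / 2 by ring,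
      show 3 / 2 - (x + y) / 2 - (y - x) / 2 = 3 / 2 - y by ring,
      show 3 / 2 - (x + y) / 2 + (y - x) / 2 = 3 / 2 - x by ring] at h
    linarith
  intro x hx y hy
  rcases lt_trichotomy x y with h | rfl | h
  · exact hlt x hx y hy h
  · simp
  · have := hlt y hy x hx h
    rw [add_comm y x, add_comm (N.norm _)] at this
    exact this

/-- The arithmetic-geometric mean inequality with `C = A ^ (1/2)`, `D = B ^ (1/2)` and
`Y = A X + X B`. -/
theorem two_mul_norm_heinzSum_three_halves_le (hA : 0 ≤ A) (hB : 0 ≤ B) (hX : X ∈ N.ideal) :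
    2 * N.norm (heinzSum A B X (3 / 2) (1 / 2)) ≤
      N.norm (A ^ 2 * X + X * B ^ 2 + (2 : ℂ) • (A * X * B)) := by
  have hY : A * X + X * B ∈ N.ideal :=
    N.ideal.add_mem (N.ideal.mul_mem_left _ _ hX) (N.ideal.mul_mem_right _ _ hX)
  have h := N.two_mul_norm_mul_mul_le (C := A ^ (1 / 2 : ℝ)) (D := B ^ (1 / 2 : ℝ))
    CFC.rpow_nonneg CFC.rpow_nonneg hY
  have hsq : ∀ S : H →L[ℂ] H, 0 ≤ S → (S ^ (1 / 2 : ℝ)) ^ 2 = S := by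
    intro S hS
    rw [rpow_sq_of_pos S (by norm_num), show (1 / 2 + 1 / 2 : ℝ) = 1 by norm_num,
      CFC.rpow_one S hS]
  have h32 : ∀ S : H →L[ℂ] H, 0 ≤ S →
      S ^ (3 / 2 : ℝ) = S ^ (1 / 2 : ℝ) * S ∧ S ^ (3 / 2 : ℝ) = S * S ^ (1 / 2 : ℝ) := by
    intro S hS
    have h1 := rpow_add_of_pos S (p := 1 / 2) (q := 1) (by norm_num) (by norm_num)
    have h2 := rpow_add_of_pos S (p := 1) (q := 1 / 2) (by norm_num) (by norm_num)
    rw [CFC.rpow_one S hS] at h1 h2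
    norm_num at h1 h2
    exact ⟨by simpa using h1, by simpa using h2⟩
  have e1 : A ^ (1 / 2 : ℝ) * (A * X + X * B) * B ^ (1 / 2 : ℝ)
      = heinzSum A B X (3 / 2) (1 / 2) := by
    rw [heinzSum, (h32 A hA).1, (h32 B hB).2]
    simp only [mul_add, add_mul, mul_assoc]
  have e2 : A * (A * X + X * B) + (A * X + X * B) * B
      = A ^ 2 * X + X * B ^ 2 + (2 : ℂ) • (A * X * B) := by
    rw [two_smul]
    simp only [sq, mul_add, add_mul, mul_assoc]
    abel
  rwa [hsq A hA, hsq B hB, e1, e2] at h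

theorem norm_heinzSum_one_one (hA : 0 ≤ A) (hB : 0 ≤ B) (hX : X ∈ N.ideal) :
    N.norm (heinzSum A B X 1 1) = 2 * N.norm (A * X * B) := by
  rw [heinzSum, CFC.rpow_one A hA, CFC.rpow_one B hB, ← two_smul ℂ,
    N.norm_smul 2 _ (N.mul_mul_mem hX A B)]
  norm_num

theorem norm_two_smul_le (hX : X ∈ N.ideal) {t : ℝ} (ht : t ≤ 2) :
    N.norm (A ^ 2 * X + X * B ^ 2 + (2 : ℂ) • (A * X * B)) ≤
      N.norm (A ^ 2 * X + X * B ^ 2 + (t : ℂ) • (A * X * B)) + (2 - t) * N.norm (A * X * B) := by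
  have hm := N.mul_mul_mem hX A B
  have hs : ∀ c : ℂ, c • (A * X * B) ∈ N.ideal := fun c => N.submodule.smul_mem c hm
  have h1 : A ^ 2 * X + X * B ^ 2 ∈ N.ideal :=
    N.ideal.add_mem (N.ideal.mul_mem_left _ _ hX) (N.ideal.mul_mem_right _ _ hX)
  have h := N.norm_add_le _ (N.ideal.add_mem h1 (hs t)) _ (hs ((2 - t : ℝ) : ℂ))
  rw [N.norm_smul _ _ hm, Complex.norm_real, Real.norm_of_nonneg (by linarith), add_assoc,
    ← add_smul] at h
  convert h using 4
  push_cast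
  ring

end UnitarilyInvariantNorm

end Heinz

/-! ### The chain of inequalities -/

theorem theorem2p1 {H : Type*} [NormedAddCommGroup H] [InnerProductSpace ℂ H] [CompleteSpace H]
    (A B : H →L[ℂ] H) (hA : A.IsPositive) (hB : B.IsPositive)
    (t r : ℝ) (ht : t ≤ 2) (hr : r ∈ Icc (1 / 2 : ℝ) (3 / 2))
    (N : UnitarilyInvariantNorm H) (X : H →L[ℂ] H) (hX : X ∈ N.ideal) :
    -- the integrals and the values at the two degenerate intervals are meaningful
    (IntervalIntegrable (fun ν => N.norm (heinzSum A B X (ν + 1 / 2) (3 / 2 - ν))) volume 0 1 ∧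
      Tendsto (fun α => 1 / α *
          ∫ ν in (0 : ℝ)..α, N.norm (heinzSum A B X (ν + 1 / 2) (3 / 2 - ν)))
        (𝓝[>] 0) (𝓝 (N.norm (heinzSum A B X (1 / 2) (3 / 2)))) ∧
      Tendsto (fun α => 1 / (1 - α) *
          ∫ ν in α..(1 : ℝ), N.norm (heinzSum A B X (ν + 1 / 2) (3 / 2 - ν)))
        (𝓝[<] 1) (𝓝 (N.norm (heinzSum A B X (3 / 2) (1 / 2))))) ∧
    -- the case `1 / 2 ≤ r ≤ 1`
    (r ∈ Icc (1 / 2 : ℝ) 1 →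
      2 * N.norm (A ^ 2 * X + X * B ^ 2 + (t : ℂ) • (A * X * B)) ≥
        2 * N.norm (A ^ 2 * X + X * B ^ 2 + (2 : ℂ) • (A * X * B))
          - (4 - 2 * t) * N.norm (A * X * B) ∧
      2 * N.norm (A ^ 2 * X + X * B ^ 2 + (2 : ℂ) • (A * X * B))
          - (4 - 2 * t) * N.norm (A * X * B) ≥
        4 * N.norm (heinzSum A B X (3 / 2) (1 / 2)) - (4 - 2 * t) * N.norm (A * X * B) ∧
      4 * N.norm (heinzSum A B X (3 / 2) (1 / 2)) - (4 - 2 * t) * N.norm (A * X * B) ≥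
        2 * N.norm (heinzSum A B X (3 / 2) (1 / 2)) + 2 * N.norm (heinzSum A B X r (2 - r))
          - (4 - 2 * t) * N.norm (A * X * B) ∧
      2 * N.norm (heinzSum A B X (3 / 2) (1 / 2)) + 2 * N.norm (heinzSum A B X r (2 - r))
          - (4 - 2 * t) * N.norm (A * X * B) ≥
        4 * intervalMean (fun ν => N.norm (heinzSum A B X (ν + 1 / 2) (3 / 2 - ν))) 0 (r - 1 / 2)
          - (4 - 2 * t) * N.norm (A * X * B) ∧
      4 * intervalMean (fun ν => N.norm (heinzSum A B X (ν + 1 / 2) (3 / 2 - ν))) 0 (r - 1 / 2)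
          - (4 - 2 * t) * N.norm (A * X * B) ≥
        4 * N.norm (heinzSum A B X ((2 * r + 1) / 4) ((7 - 2 * r) / 4))
          - (4 - 2 * t) * N.norm (A * X * B) ∧
      4 * N.norm (heinzSum A B X ((2 * r + 1) / 4) ((7 - 2 * r) / 4))
          - (4 - 2 * t) * N.norm (A * X * B) ≥
        4 * N.norm (heinzSum A B X r (2 - r)) - (4 - 2 * t) * N.norm (A * X * B) ∧
      4 * N.norm (heinzSum A B X r (2 - r)) - (4 - 2 * t) * N.norm (A * X * B) ≥
        (t + 2) * N.norm (heinzSum A B X r (2 - r))) ∧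
    -- the case `1 ≤ r ≤ 3 / 2`
    (r ∈ Icc (1 : ℝ) (3 / 2) →
      2 * N.norm (A ^ 2 * X + X * B ^ 2 + (t : ℂ) • (A * X * B)) ≥
        2 * N.norm (A ^ 2 * X + X * B ^ 2 + (2 : ℂ) • (A * X * B))
          - (4 - 2 * t) * N.norm (A * X * B) ∧
      2 * N.norm (A ^ 2 * X + X * B ^ 2 + (2 : ℂ) • (A * X * B))
          - (4 - 2 * t) * N.norm (A * X * B) ≥
        4 * N.norm (heinzSum A B X (3 / 2) (1 / 2)) - (4 - 2 * t) * N.norm (A * X * B) ∧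
      4 * N.norm (heinzSum A B X (3 / 2) (1 / 2)) - (4 - 2 * t) * N.norm (A * X * B) ≥
        2 * N.norm (heinzSum A B X (3 / 2) (1 / 2)) + 2 * N.norm (heinzSum A B X r (2 - r))
          - (4 - 2 * t) * N.norm (A * X * B) ∧
      2 * N.norm (heinzSum A B X (3 / 2) (1 / 2)) + 2 * N.norm (heinzSum A B X r (2 - r))
          - (4 - 2 * t) * N.norm (A * X * B) ≥
        4 * intervalMean (fun ν => N.norm (heinzSum A B X (ν + 1 / 2) (3 / 2 - ν))) (r - 1 / 2) 1
          - (4 - 2 * t) * N.norm (A * X * B) ∧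
      4 * intervalMean (fun ν => N.norm (heinzSum A B X (ν + 1 / 2) (3 / 2 - ν))) (r - 1 / 2) 1
          - (4 - 2 * t) * N.norm (A * X * B) ≥
        4 * N.norm (heinzSum A B X ((2 * r + 3) / 4) ((5 - 2 * r) / 4))
          - (4 - 2 * t) * N.norm (A * X * B) ∧
      4 * N.norm (heinzSum A B X ((2 * r + 3) / 4) ((5 - 2 * r) / 4))
          - (4 - 2 * t) * N.norm (A * X * B) ≥
        4 * N.norm (heinzSum A B X r (2 - r)) - (4 - 2 * t) * N.norm (A * X * B) ∧
      4 * N.norm (heinzSum A B X r (2 - r)) - (4 - 2 * t) * N.norm (A * X * B) ≥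
        (t + 2) * N.norm (heinzSum A B X r (2 - r))) := by
  rw [← ContinuousLinearMap.nonneg_iff_isPositive] at hA hB
  set F : ℝ → ℝ := fun ν => N.norm (heinzSum A B X (ν + 1 / 2) (3 / 2 - ν)) with hF
  have hconv : ConvexOn ℝ (Icc 0 1) F := N.convexOn_norm_heinzSum hX
  have hcont : ContinuousOn F (Icc 0 1) := N.continuousOn_norm_heinzSum hX
  have hsymm : ∀ x, F (1 - x) = F x := by
    intro x
    simp only [hF]
    rw [heinzSum_comm]
    congr 2 <;> ring
  have hanti : AntitoneOn F (Icc 0 (1 / 2)) := hconv.antitoneOn_of_symm hsymm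
  have heq : ∀ p q : ℝ, q = 2 - p → N.norm (heinzSum A B X p q) = F (p - 1 / 2) := by
    rintro p q rfl
    simp only [hF]
    congr 2 <;> ring
  have h01 : F 0 = F 1 := by rw [← hsymm 0, sub_zero]
  have hmid : F (1 / 2) = 2 * N.norm (A * X * B) := by
    rw [← N.norm_heinzSum_one_one hA hB hX, heq 1 1 (by norm_num)]
    norm_num
  have hleft := hconv.tendsto_mean_right hcont
  have hright := tendsto_mean_left_of_symm hsymm hleft
  have hint : IntervalIntegrable F volume 0 1 :=
    hcont.intervalIntegrable_of_Icc zero_le_one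
  have htri := N.norm_two_smul_le (A := A) (B := B) hX ht
  have hamgm := N.two_mul_norm_heinzSum_three_halves_le hA hB hX
  rw [heq (3 / 2) (1 / 2) (by norm_num), show (3 / 2 - 1 / 2 : ℝ) = 1 by norm_num] at hamgm ⊢
  rw [heq (1 / 2) (3 / 2) (by norm_num), sub_self, heq r (2 - r) rfl]
  have hsub : (2 - t) * F (1 / 2) = (4 - 2 * t) * N.norm (A * X * B) := by rw [hmid]; ring
  refine ⟨⟨hint, hleft, hright⟩, fun h => ?_, fun h => ?_⟩
  · rw [heq ((2 * r + 1) / 4) ((7 - 2 * r) / 4) (by ring),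
      show (2 * r + 1) / 4 - 1 / 2 = (0 + (r - 1 / 2)) / 2 by ring]
    set α := r - 1 / 2 with hα
    have hα0 : 0 ≤ α := by linarith [h.1]
    have hα1 : α ≤ 1 / 2 := by linarith [h.2]
    have hIcc : Icc 0 α ⊆ Icc (0 : ℝ) 1 := Icc_subset_Icc_right (by linarith)
    obtain ⟨hm1, hm2⟩ := (hconv.subset hIcc (convex_Icc _ _)).midpoint_le_intervalMean
      (hcont.mono hIcc) hα0
    have a1 : F α ≤ F 0 := hanti (by simp) ⟨hα0, hα1⟩ hα0
    have a2 : F α ≤ F ((0 + α) / 2) := hanti ⟨by linarith, by linarith⟩ ⟨hα0, hα1⟩ (by linarith)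
    have a3 : F (1 / 2) ≤ F α := hanti ⟨hα0, hα1⟩ (by simp) hα1
    have a4 : (2 - t) * F (1 / 2) ≤ (2 - t) * F α :=
      mul_le_mul_of_nonneg_left a3 (by linarith)
    refine ⟨?_, ?_, ?_, ?_, ?_, ?_, ?_⟩ <;> linarith
  · rw [heq ((2 * r + 3) / 4) ((5 - 2 * r) / 4) (by ring),
      show (2 * r + 3) / 4 - 1 / 2 = (r - 1 / 2 + 1) / 2 by ring]
    set α := r - 1 / 2 with hα
    have hα0 : 1 / 2 ≤ α := by linarith [h.1]
    have hα1 : α ≤ 1 := by linarith [h.2]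
    have hIcc : Icc α 1 ⊆ Icc (0 : ℝ) 1 := Icc_subset_Icc_left (by linarith)
    obtain ⟨hm1, hm2⟩ := (hconv.subset hIcc (convex_Icc _ _)).midpoint_le_intervalMean
      (hcont.mono hIcc) hα1
    -- the symmetry about `1 / 2` reduces monotonicity to the left half of the interval
    have b1 := hsymm α
    have b2 := hsymm ((α + 1) / 2)
    have hαI : 1 - α ∈ Icc (0 : ℝ) (1 / 2) := ⟨by linarith, by linarith⟩
    have a1 : F (1 - α) ≤ F 0 := hanti (by simp) hαI hαI.1
    have a2 : F (1 - α) ≤ F (1 - (α + 1) / 2) :=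
      hanti ⟨by linarith, by linarith⟩ hαI (by linarith)
    have a3 : F (1 / 2) ≤ F (1 - α) := hanti hαI (by simp) hαI.2
    have a4 : (2 - t) * F (1 / 2) ≤ (2 - t) * F α :=
      mul_le_mul_of_nonneg_left (b1 ▸ a3) (by linarith)
    refine ⟨?_, ?_, ?_, ?_, ?_, ?_, ?_⟩ <;> linarith
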